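/- Let $k$ be an algebraically closed field and let $\Lambda$ be a finite dimensional associative unital $k$-algebra. Put $\Lambda^{\mathrm e}=\Lambda\otimes_k\Lambda^{\mathrm{op}}$ and regard $\Lambda$ as a left $\Lambda^{\mathrm e}$-module via $(a\otimes b^{\mathrm{op}})x=axb$. For a finite dimensional algebra $R$ and a finitely generated left $R$-module $M$, let $\Omega^0_R(M)=M$, let $\Omega_R(M)$ be the kernel of a projective cover of $M$, and let $\Omega_R^{n}$ be the $n$-th iterate of $\Omega_R$ (all well defined up to isomorphism); $M$ is called periodic if $\Omega^p_R(M)\cong M$ for some $p>0$. Let $d\ge 0$ be an integer and suppose that $\Lambda$ is $d$-Gorenstein, i.e. the injective dimensions of $\Lambda$ as a left and as a right $\Lambda$-module are both finite and the former equals $d$ (the zero module has injective dimension $-\infty$, so $\Lambda\ne 0$). Assume that there is an integer $n\ge 0$ such that the $\Lambda^{\mathrm e}$-module $\Omega^n_{\Lambda^{\mathrm e}}(\Lambda)$ is periodic. Then the least such integer $n$ satisfies $n\ge d$. Moreover, for this least $n$, the equality $n=d$ holds if and only if there exists a simple left $\Lambda$-module $S$ with $\operatorname{Ext}^n_\Lambda(S,\Lambda)\neq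 0$. -/

import Mathlib

open CategoryTheory TensorProduct
open scoped MulOpposite

universe u v

/-- `f : P ⟶ M` is a projective cover in the category of finitely generated left `R`-modules:
`P` is finitely generated projective, `f` is surjective, and the kernel of `f` is superfluous
in `P`. -/
structure IsProjectiveCover {R : Type u} [Ring R] {P M : ModuleCat.{u} R} (f : P ⟶ M) : Prop where
  finite : Module.Finite R P
  projective : Module.Projective R P
  surjective : Function.Surjective f.hom
  superfluous : ∀ L : Submodule R P, L ⊔ LinearMap.ker f.hom = ⊤ → L = ⊤

/-- `IsSyzygy n M N` says that `N` is isomorphic to the `n`-th (minimal) syzygy `Ωⁿ(M)` of `M`: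
`Ω⁰(M) = M`, and `Ωⁿ⁺¹(M) = Ωⁿ(Ω(M))`, where `Ω(M)` is the kernel of a projective cover of `M`.
(Projective covers are unique up to isomorphism, so `Ωⁿ(M)` is determined by `M` up to
isomorphism; over a finite dimensional algebra it exists for every finitely generated `M`.) -/
def IsSyzygy {R : Type u} [Ring R] : ℕ → ModuleCat.{u} R → ModuleCat.{u} R → Prop
  | 0, M, N => Nonempty (M ≅ N)
  | n + 1, M, N => ∃ (P : ModuleCat.{u} R) (f : P ⟶ M), IsProjectiveCover f ∧
      IsSyzygy n (ModuleCat.of R (LinearMap.ker f.hom)) N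

/-- `M` is periodic: `Ωᵖ(M) ≅ M` for some `p > 0`. -/
def IsPeriodicModule {R : Type u} [Ring R] (M : ModuleCat.{u} R) : Prop :=
  ∃ p : ℕ, 0 < p ∧ IsSyzygy p M M

/-- The `n`-th syzygy `Ωⁿ(M)` of `M` is periodic. -/
def HasPeriodicSyzygy {R : Type u} [Ring R] (M : ModuleCat.{u} R) (n : ℕ) : Prop :=
  ∃ N : ModuleCat.{u} R, IsSyzygy n M N ∧ IsPeriodicModule N

/-- The enveloping algebra `Λᵉ = Λ ⊗ₖ Λᵒᵖ`. -/
abbrev EnvelopingAlgebra (k : Type v) [Field k] (Λ : Type u) [Ring Λ] [Algebra k Λ] : Type u :=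
  Λ ⊗[k] Λᵐᵒᵖ

/-- `Λ` as a left module over `Λᵉ`, with `(a ⊗ bᵒᵖ) • x = a * x * b`. -/
noncomputable def regularBimodule (k : Type v) [Field k] (Λ : Type u) [Ring Λ] [Algebra k Λ] :
    ModuleCat.{u} (EnvelopingAlgebra k Λ) :=
  letI : Module (EnvelopingAlgebra k Λ) Λ := TensorProduct.Algebra.module
  ModuleCat.of (EnvelopingAlgebra k Λ) Λ

theorem regularBimodule_smul (k : Type v) [Field k] (Λ : Type u) [Ring Λ] [Algebra k Λ]
    (a b x : Λ) :
    ((a ⊗ₜ[k] MulOpposite.op b : EnvelopingAlgebra k Λ) • (show regularBimodule k Λ from x) :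
      regularBimodule k Λ) = (show regularBimodule k Λ from a * x * b) :=
  (mul_assoc a x b).symm

/-- `Λ` is `d`-Gorenstein: the injective dimensions of `Λ` as a left module and as a right module
(that is, as a left `Λᵒᵖ`-module) are finite, and the former equals `d`. The injective dimension
of the zero module is `⊥`, so a `d`-Gorenstein algebra is nonzero. -/
structure IsDGorenstein (Λ : Type u) [Ring Λ] (d : ℕ) : Prop where
  left_eq : injectiveDimension (ModuleCat.of Λ Λ) = d
  right_lt_top : injectiveDimension (ModuleCat.of Λᵐᵒᵖ Λ) < ⊤

/-! ### Injective dimension tested on simple modules. -/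

section InjectiveDimension

open Abelian

variable {R : Type u} [Ring R]

/-! Fix a left `Λ`-module `Y` and apply `Hom_Λ(-, Y)` to the minimal `Λᵉ`-projective resolution of
`Λ`. All syzygies are left projective, so exactness is preserved; projectives become injective
(`LeftHom.injective_functor_obj`) and `Λ` becomes `Y`. The result is an injective coresolution of
`Y` with cosyzygies `Hom_Λ(Ωⁿ(Λ), Y)`. If `Ωⁿ(Λ)` is periodic, its image is its own cosyzygy of some
positive order, hence injective once `Y` has finite injective dimension; that dimension is then at
most `n`. Taking `Y = Λ` gives `d ≤ n`. For the equality, the injective dimension of a module over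
an Artinian ring is detected by `Ext` from simple modules. -/

theorem subsingleton_ext_of_isFiniteLength {Y : ModuleCat.{u} R} {n : ℕ}
    (h : ∀ S : ModuleCat.{u} R, IsSimpleModule R S → Subsingleton (Ext S Y n))
    {M : Type u} [AddCommGroup M] [Module R M] (hM : IsFiniteLength R M) :
    Subsingleton (Ext (ModuleCat.of R M) Y n) := by
  induction hM with
  | of_subsingleton =>
    rename_i M _ _ _
    have hz : Limits.IsZero (ModuleCat.of R M) := ModuleCat.isZero_of_subsingleton _
    refine subsingleton_of_forall_eq 0 fun e ↦ ?_
    rw [← e.mk₀_id_comp, hz.eq_zero_of_src (𝟙 _), Ext.mk₀_zero, Ext.zero_comp]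
  | of_simple_quotient _ ih =>
    rename_i M _ _ N hN _
    have hS := LinearMap.shortExact_shortComplexKer (R := R) (Submodule.mkQ_surjective N)
    have hker : LinearMap.ker N.mkQ = N := N.ker_mkQ
    have h₁ : Subsingleton (Ext (ModuleCat.of R (LinearMap.ker N.mkQ)) Y n) := by
      rw [hker]; exact ih
    have h₃ := h (ModuleCat.of R (M ⧸ N)) hN
    refine subsingleton_of_forall_eq 0 fun e ↦ ?_
    obtain ⟨x, rfl⟩ := Ext.contravariant_sequence_exact₂ hS Y e (h₁.elim _ _)
    rw [h₃.elim x 0, Ext.comp_zero]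

/-- Baer's criterion, followed by dimension shifting along an embedding of `Y` into an injective. -/
theorem hasInjectiveDimensionLE_of_subsingleton_ext_ideal (n : ℕ) (Y : ModuleCat.{u} R)
    (h : ∀ I : Ideal R, Subsingleton (Ext (ModuleCat.of R (R ⧸ I)) Y (n + 1))) :
    HasInjectiveDimensionLE Y n := by
  induction n generalizing Y with
  | zero =>
    rw [HasInjectiveDimensionLE, zero_add, ← injective_iff_hasInjectiveDimensionLT_one]
    suffices Module.Baer R Y by
      have := this.injective
      exact Module.injective_object_of_injective_module R Y
    intro I g
    have hS := LinearMap.shortExact_shortComplexKer (R := R) (Submodule.mkQ_surjective I)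
    have hker : LinearMap.ker I.mkQ = I := I.ker_mkQ
    let g' : ModuleCat.of R (LinearMap.ker I.mkQ) ⟶ Y :=
      ModuleCat.ofHom (g ∘ₗ (LinearEquiv.ofEq _ _ hker).toLinearMap)
    -- The obstruction to extending `g` from `I` to `R` lies in `Ext¹(R/I, Y) = 0`.
    obtain ⟨x, hx⟩ := Ext.contravariant_sequence_exact₁ hS Y (Ext.mk₀ g') (zero_add 1)
      ((h I).elim _ _)
    obtain ⟨φ, rfl⟩ := Ext.homEquiv₀.symm.surjective x
    have hφ : ModuleCat.ofHom (LinearMap.ker I.mkQ).subtype ≫ φ = g' :=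
      Ext.homEquiv₀.symm.injective (by simpa using hx)
    refine ⟨φ.hom, fun x hx ↦ ?_⟩
    exact congr($hφ ⟨x, hker.symm ▸ hx⟩)
  | succ n ih =>
    let p := Classical.choice (EnoughInjectives.presentation Y)
    have hS : (ShortComplex.mk _ _ (Limits.cokernel.condition p.f)).ShortExact :=
      { exact := ShortComplex.exact_cokernel p.f }
    have hinj : Injective (ShortComplex.mk _ _ (Limits.cokernel.condition p.f)).X₂ :=
      inferInstanceAs (Injective p.J)
    refine (hS.hasInjectiveDimensionLT_X₃_iff n hinj).1 (ih _ fun I ↦ ?_)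
    refine subsingleton_of_forall_eq 0 fun e ↦ ?_
    obtain ⟨x, rfl⟩ := Ext.covariant_sequence_exact₃ _ hS e rfl ((h I).elim _ _)
    rw [Ext.eq_zero_of_injective x, Ext.zero_comp]

theorem hasInjectiveDimensionLT_of_subsingleton_ext_simple [IsArtinianRing R] {n : ℕ}
    {Y : ModuleCat.{u} R}
    (h : ∀ S : ModuleCat.{u} R, IsSimpleModule R S → Subsingleton (Ext S Y n)) :
    HasInjectiveDimensionLT Y n := by
  have key (M : Type u) [AddCommGroup M] [Module R M] [Module.Finite R M] :
      Subsingleton (Ext (ModuleCat.of R M) Y n) :=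
    subsingleton_ext_of_isFiniteLength h
      (isFiniteLength_iff_isNoetherian_isArtinian.2 ⟨inferInstance, inferInstance⟩)
  cases n with
  | succ n => exact hasInjectiveDimensionLE_of_subsingleton_ext_ideal n Y fun I ↦ key _
  | zero =>
    -- Dimension `< 0` means `Y = 0`, which follows from `Hom(R, Y) ≅ Y`.
    have : Subsingleton (ModuleCat.of R R ⟶ Y) :=
      have := key R
      Ext.homEquiv₀.symm.injective.subsingleton
    refine Limits.IsZero.hasInjectiveDimensionLT_zero ?_
    rw [ModuleCat.isZero_iff_subsingleton]
    refine subsingleton_of_forall_eq 0 fun y ↦ ?_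
    have := Subsingleton.elim (ModuleCat.ofHom (LinearMap.toSpanSingleton R Y y)) 0
    simpa using congr($this (1 : R))

end InjectiveDimension

/-! ### The functor `Hom_Λ(-, Y)` on bimodules and its exactness. -/

section LeftHom

variable {k : Type v} [Field k] {Λ : Type u} [Ring Λ] [Algebra k Λ]

/-- The left `Λ`-module underlying a `Λᵉ`-module. -/
abbrev leftModuleOfEnveloping (X : ModuleCat.{u} (EnvelopingAlgebra k Λ)) : Module Λ X :=
  Module.compHom X (Algebra.TensorProduct.includeLeftRingHom : Λ →+* EnvelopingAlgebra k Λ)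

attribute [local instance] leftModuleOfEnveloping

theorem leftModuleOfEnveloping_smul (X : ModuleCat.{u} (EnvelopingAlgebra k Λ)) (a : Λ) (x : X) :
    a • x = (a ⊗ₜ[k] (1 : Λᵐᵒᵖ) : EnvelopingAlgebra k Λ) • x := rfl

theorem isScalarTower_leftModuleOfEnveloping (X : ModuleCat.{u} (EnvelopingAlgebra k Λ)) :
    IsScalarTower Λ (EnvelopingAlgebra k Λ) X where
  smul_assoc a e x := by
    rw [leftModuleOfEnveloping_smul, ← mul_smul]
    congr 1
    induction e using TensorProduct.induction_on with
    | zero => simp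
    | tmul b c => simp [smul_tmul']
    | add e e' h h' => rw [smul_add, mul_add, h, h']

attribute [local instance] isScalarTower_leftModuleOfEnveloping

theorem smul_rightAction_comm (X : ModuleCat.{u} (EnvelopingAlgebra k Λ)) (a : Λ) (b : Λᵐᵒᵖ)
    (x : X) : ((1 : Λ) ⊗ₜ[k] b : EnvelopingAlgebra k Λ) • a • x =
      a • ((1 : Λ) ⊗ₜ[k] b : EnvelopingAlgebra k Λ) • x := by
  simp [leftModuleOfEnveloping_smul, ← mul_smul]

/-- The group `Hom_Λ(X, Y)` of left `Λ`-linear maps from a `Λᵉ`-module `X`. -/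
def LeftHom (X : ModuleCat.{u} (EnvelopingAlgebra k Λ)) (Y : ModuleCat.{u} Λ) : Type u :=
  X →ₗ[Λ] Y

namespace LeftHom

variable {X X' P : ModuleCat.{u} (EnvelopingAlgebra k Λ)} {Y : ModuleCat.{u} Λ}

instance : AddCommGroup (LeftHom X Y) := inferInstanceAs (AddCommGroup (X →ₗ[Λ] Y))

instance : FunLike (LeftHom X Y) X Y := inferInstanceAs (FunLike (X →ₗ[Λ] Y) X Y)

instance : LinearMapClass (LeftHom X Y) Λ X Y :=
  inferInstanceAs (LinearMapClass (X →ₗ[Λ] Y) Λ X Y)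

@[ext]
theorem ext {f g : LeftHom X Y} (h : ∀ x, f x = g x) : f = g := LinearMap.ext h

/-- The right action of `Λ` on `X` makes `Hom_Λ(X, Y)` a left `Λ`-module. -/
instance : SMul Λ (LeftHom X Y) where
  smul b f :=
    { toFun x := f ((1 ⊗ₜ[k] MulOpposite.op b : EnvelopingAlgebra k Λ) • x)
      map_add' x y := by rw [smul_add, map_add]
      map_smul' a x := by rw [smul_rightAction_comm, map_smul]; rfl }

@[simp]
theorem smul_apply (b : Λ) (f : LeftHom X Y) (x : X) :
    (b • f) x = f ((1 ⊗ₜ[k] MulOpposite.op b : EnvelopingAlgebra k Λ) • x) := rfl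

@[simp]
theorem add_apply (f g : LeftHom X Y) (x : X) : (f + g) x = f x + g x := rfl

@[simp]
theorem zero_apply (x : X) : (0 : LeftHom X Y) x = 0 := rfl

instance : Module Λ (LeftHom X Y) where
  one_smul f := by
    ext x
    rw [smul_apply, MulOpposite.op_one, ← Algebra.TensorProduct.one_def, one_smul]
  mul_smul a b f := by
    ext x
    simp [← mul_smul]
  smul_zero a := by ext x; simp
  smul_add a f g := by ext x; simp
  add_smul a b f := by ext x; simp [tmul_add, add_smul]
  zero_smul f := by ext x; simp [-zero_smul, zero_smul (EnvelopingAlgebra k Λ) x]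

/-- Precomposition with a morphism of `Λᵉ`-modules. -/
def precomp (Y : ModuleCat.{u} Λ) (f : X ⟶ X') : LeftHom X' Y →ₗ[Λ] LeftHom X Y where
  toFun g := LinearMap.comp (σ₁₂ := RingHom.id Λ) (M₂ := X') g (f.hom.restrictScalars Λ)
  map_add' g g' := rfl
  map_smul' b g := by
    ext x
    exact congrArg g (map_smul f.hom _ _).symm

@[simp]
theorem precomp_apply (f : X ⟶ X') (g : LeftHom X' Y) (x : X) : precomp Y f g x = g (f x) := rfl

variable (k) in
/-- The contravariant functor `Hom_Λ(-, Y)` from `Λᵉ`-modules to left `Λ`-modules. -/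
def functor (Y : ModuleCat.{u} Λ) : (ModuleCat.{u} (EnvelopingAlgebra k Λ))ᵒᵖ ⥤
    ModuleCat.{u} Λ where
  obj X := ModuleCat.of Λ (LeftHom X.unop Y)
  map f := ModuleCat.ofHom (precomp Y f.unop)

instance (Y : ModuleCat.{u} Λ) : (functor k Y).Additive where
  map_add {_ _ f g} := by
    ext h
    exact LeftHom.ext fun x ↦ map_add (show LeftHom _ Y from h) _ _

theorem precomp_injective (Y : ModuleCat.{u} Λ) {g : X ⟶ X'} (hg : Function.Surjective g) :
    Function.Injective (precomp Y g) := fun h h' e ↦ by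
  ext x
  obtain ⟨x, rfl⟩ := hg x
  exact DFunLike.congr_fun e x

theorem exists_retraction {f : X ⟶ P} {g : P ⟶ X'} (hf : Function.Injective f)
    (hfg : Function.Exact f g) (hg : Function.Surjective g) [Module.Projective Λ X'] :
    ∃ r : P →ₗ[Λ] X, ∀ x, r (f x) = x := by
  obtain ⟨s, hs⟩ := Module.projective_lifting_property (g.hom.restrictScalars Λ) LinearMap.id hg
  have hfg' : Function.Exact (f.hom.restrictScalars Λ) (g.hom.restrictScalars Λ) := hfg
  obtain ⟨r, hr⟩ := ((hfg'.split_tfae hf hg).out 0 1 rfl rfl).1 ⟨s, hs⟩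
  exact ⟨r, LinearMap.congr_fun hr⟩

theorem precomp_surjective (Y : ModuleCat.{u} Λ) {f : X ⟶ P} {g : P ⟶ X'}
    (hf : Function.Injective f) (hfg : Function.Exact f g) (hg : Function.Surjective g)
    [Module.Projective Λ X'] : Function.Surjective (precomp Y f) := fun h ↦ by
  obtain ⟨r, hr⟩ := exists_retraction hf hfg hg
  exact ⟨LinearMap.comp (M₂ := X) (σ₁₂ := RingHom.id Λ) h r, LeftHom.ext fun x ↦ congrArg h (hr x)⟩

theorem precomp_exact (Y : ModuleCat.{u} Λ) {f : X ⟶ P} {g : P ⟶ X'}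
    (hfg : Function.Exact f g) (hg : Function.Surjective g)
    [Module.Projective Λ X'] : Function.Exact (precomp Y g) (precomp Y f) := fun h ↦ by
  refine ⟨fun h0 ↦ ?_, ?_⟩
  · obtain ⟨s, hs⟩ :=
      Module.projective_lifting_property (g.hom.restrictScalars Λ) LinearMap.id hg
    refine ⟨LinearMap.comp (M₂ := P) (σ₁₂ := RingHom.id Λ) h s, LeftHom.ext fun x ↦ ?_⟩
    obtain ⟨z, hz⟩ := (hfg (x - s (g x))).1 (by
      rw [map_sub, sub_eq_zero]; exact (LinearMap.congr_fun hs _).symm)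
    have h1 : h (x - s (g x)) = 0 := by rw [← hz]; exact DFunLike.congr_fun h0 z
    rw [map_sub, sub_eq_zero] at h1
    exact h1.symm
  · rintro ⟨h, rfl⟩
    ext x
    rw [precomp_apply, precomp_apply, hfg.apply_apply_eq_zero, map_zero, zero_apply]

/-- A left projective third term splits the sequence over `Λ`, though not over `Λᵉ`; any `Hom_Λ(-,
Y)` preserves split sequences. -/
theorem shortExact_functor (Y : ModuleCat.{u} Λ)
    {S : ShortComplex (ModuleCat.{u} (EnvelopingAlgebra k Λ))}
    (hS : S.ShortExact) [hP : Module.Projective Λ S.X₃] :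
    (S.op.map (functor k Y)).ShortExact :=
  have hf := hS.moduleCat_injective_f
  have hg := hS.moduleCat_surjective_g
  have hfg : Function.Exact S.f S.g :=
    (ShortComplex.ShortExact.moduleCat_exact_iff_function_exact S).1 hS.exact
  ModuleCat.shortComplex_shortExact _ (precomp_exact (X' := S.X₃) Y hfg hg) (precomp_injective Y hg)
    (precomp_surjective (X' := S.X₃) Y hf hfg hg)

end LeftHom

/-! ### Projective bimodules are sent to injective modules. -/

section Coinduced

variable (k)

open ModuleCat

/-- The `Λᵉ`-module structure on `Hom_k(A, Y)` with `((a ⊗ b) • g) z = a • g (b • z)`. -/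
noncomputable def envelopingToEnd (A Y : ModuleCat.{u} Λ) :
    EnvelopingAlgebra k Λ →ₐ[k] Module.End k (A →ₗ[k] Y) :=
  Algebra.TensorProduct.lift
    (AlgHom.ofLinearMap
      { toFun a := LinearMap.llcomp k A Y Y (Algebra.lsmul k k Y a)
        map_add' a b := by ext; simp
        map_smul' c a := by ext; simp }
      (by ext; simp) (fun a b ↦ by ext; simp))
    (AlgHom.ofLinearMap
      { toFun b := LinearMap.lcomp k Y (Algebra.lsmul k k A b.unop)
        map_add' a b := by ext; simp
        map_smul' c a := by ext; simp }
      (by ext; simp) (fun a b ↦ by ext; simp))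
    (fun a b ↦ by ext; simp)

theorem envelopingToEnd_tmul_apply (A Y : ModuleCat.{u} Λ) (a : Λ) (b : Λᵐᵒᵖ) (g : A →ₗ[k] Y)
    (z : A) : envelopingToEnd k A Y (a ⊗ₜ b) g z = a • g (b.unop • z) :=
  rfl

variable {k} in
/-- An additive map that commutes with pure tensors is `Λᵉ`-linear. -/
def AddMonoidHom.toEnvelopingLinearMap {M N : Type*} [AddCommGroup M] [AddCommGroup N]
    [Module (EnvelopingAlgebra k Λ) M] [Module (EnvelopingAlgebra k Λ) N] (f : M →+ N)
    (hf : ∀ (a : Λ) (b : Λᵐᵒᵖ) (x : M), f ((a ⊗ₜ b : EnvelopingAlgebra k Λ) • x) =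
      (a ⊗ₜ b : EnvelopingAlgebra k Λ) • f x) : M →ₗ[EnvelopingAlgebra k Λ] N where
  __ := f
  map_smul' e x := by
    change f (e • x) = e • f x
    induction e using TensorProduct.induction_on with
    | zero =>
      exact (congrArg f (zero_smul (EnvelopingAlgebra k Λ) x)).trans
        ((map_zero f).trans (zero_smul (EnvelopingAlgebra k Λ) (f x)).symm)
    | tmul a b => exact hf a b x
    | add e e' h h' => rw [add_smul, add_smul, map_add, h, h']

/-- By adjunction, `Hom_Λ(A, Hom_Λ(P, Y)) ≅ Hom_{Λᵉ}(P, Hom_k(A, Y))`. The right side is exact in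
`A`, since `k` is a field and `P` is projective. -/
theorem LeftHom.injective_functor_obj (P : ModuleCat.{u} (EnvelopingAlgebra k Λ))
    [Module.Projective (EnvelopingAlgebra k Λ) P] (Y : ModuleCat.{u} Λ) :
    Injective ((functor k Y).obj (.op P)) where
  factors {A B} g f hf := by
    let (A : ModuleCat.{u} Λ) : Module (EnvelopingAlgebra k Λ) (A →ₗ[k] Y) :=
      Module.compHom _ (envelopingToEnd k A Y).toRingHom
    have smul_tmul_apply (A : ModuleCat.{u} Λ) (a : Λ) (b : Λᵐᵒᵖ) (h : A →ₗ[k] Y) (z : A) :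
        ((a ⊗ₜ b : EnvelopingAlgebra k Λ) • h) z = a • h (b.unop • z) :=
      envelopingToEnd_tmul_apply k A Y a b h z
    have tmul_smul_eq (a : Λ) (b : Λᵐᵒᵖ) (x : P) : (a ⊗ₜ b : EnvelopingAlgebra k Λ) • x =
        a • (1 ⊗ₜ b : EnvelopingAlgebra k Λ) • x := by
      simp [leftModuleOfEnveloping_smul, ← mul_smul]
    let g' : A →ₗ[Λ] LeftHom P Y := g.hom
    let f' : A →ₗ[k] B := f.hom.restrictScalars k
    let restrict : (B →ₗ[k] Y) →ₗ[EnvelopingAlgebra k Λ] (A →ₗ[k] Y) :=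
      (LinearMap.lcomp k Y f').toAddMonoidHom.toEnvelopingLinearMap fun a b h ↦ by
        ext z
        change ((a ⊗ₜ b : EnvelopingAlgebra k Λ) • h) (f' z) = _
        rw [smul_tmul_apply, smul_tmul_apply]
        exact congr(a • h $((map_smul f.hom b.unop z).symm))
    have restrict_surjective : Function.Surjective restrict := fun h ↦ by
      obtain ⟨r, hr⟩ := f'.exists_leftInverse_of_injective
        (LinearMap.ker_eq_bot.2 ((ModuleCat.mono_iff_injective f).1 hf))
      exact ⟨h ∘ₗ r, by
        change (h ∘ₗ r) ∘ₗ f' = h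
        rw [LinearMap.comp_assoc, hr, LinearMap.comp_id]⟩
    let ψ' : P →+ (A →ₗ[k] Y) :=
      { toFun x :=
          { toFun z := g' z x
            map_add' z z' := by simp
            map_smul' c z := by
              change g' (algebraMap k Λ c • z) x = algebraMap k Λ c • g' z x
              rw [map_smul, LeftHom.smul_apply, ← map_smul, leftModuleOfEnveloping_smul]
              congr 2
              rw [Algebra.algebraMap_eq_smul_one, ← smul_tmul', MulOpposite.op_smul,
                MulOpposite.op_one, tmul_smul] }
        map_zero' := by ext z; exact map_zero (g' z)
        map_add' x y := by ext z; exact map_add (g' z) x y }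
    -- The adjoint transpose of `g`; its lift `φ` along `restrict` is transposed back to `l`.
    let ψ : P →ₗ[EnvelopingAlgebra k Λ] (A →ₗ[k] Y) :=
      ψ'.toEnvelopingLinearMap fun a b x ↦ by
        ext z
        rw [smul_tmul_apply]
        change g' z _ = a • g' (b.unop • z) x
        rw [tmul_smul_eq, map_smul (g' z) a, map_smul g' b.unop z, LeftHom.smul_apply,
          MulOpposite.op_unop]
    obtain ⟨φ, hφ⟩ := Module.projective_lifting_property restrict ψ restrict_surjective
    let l : B →ₗ[Λ] LeftHom P Y :=
      { toFun z :=
          { toFun x := φ x z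
            map_add' x y := by simp
            map_smul' a x := by
              rw [leftModuleOfEnveloping_smul, map_smul, smul_tmul_apply, MulOpposite.unop_one,
                one_smul, RingHom.id_apply] }
        map_add' z z' := LeftHom.ext fun x ↦ map_add (φ x) z z'
        map_smul' b z := LeftHom.ext fun x ↦ by
          change φ x (b • z) = φ ((1 ⊗ₜ .op b : EnvelopingAlgebra k Λ) • x) z
          rw [LinearMap.map_smul, smul_tmul_apply, one_smul, MulOpposite.unop_op] }
    refine ⟨ModuleCat.ofHom l, ?_⟩
    ext z
    exact LeftHom.ext fun x ↦ LinearMap.congr_fun (LinearMap.congr_fun hφ x) z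

end Coinduced

/-! ### Dimension shifting along syzygies, and periodicity. -/

theorem projective_left_of_projective (P : ModuleCat.{u} (EnvelopingAlgebra k Λ))
    [Module.Projective (EnvelopingAlgebra k Λ) P] : Module.Projective Λ P := by
  obtain ⟨s, hs⟩ := ‹Module.Projective (EnvelopingAlgebra k Λ) P›
  exact Module.Projective.of_split (s.restrictScalars Λ)
    ((Finsupp.linearCombination _ id).restrictScalars Λ) (LinearMap.ext hs)

theorem projective_left_kernel {S : ShortComplex (ModuleCat.{u} (EnvelopingAlgebra k Λ))}
    (hS : S.ShortExact) [Module.Projective Λ S.X₂] [Module.Projective Λ S.X₃] :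
    Module.Projective Λ S.X₁ := by
  obtain ⟨r, hr⟩ := LeftHom.exists_retraction hS.moduleCat_injective_f
    ((ShortComplex.ShortExact.moduleCat_exact_iff_function_exact S).1 hS.exact)
    hS.moduleCat_surjective_g
  exact Module.Projective.of_split (S.f.hom.restrictScalars Λ) r (LinearMap.ext hr)

theorem projective_left_of_iso {M N : ModuleCat.{u} (EnvelopingAlgebra k Λ)} (e : M ≅ N)
    [Module.Projective Λ M] : Module.Projective Λ N :=
  Module.Projective.of_equiv (e.toLinearEquiv.restrictScalars Λ)

/-- Each projective cover yields a short exact sequence with injective middle term, shifting the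
dimension by one. Left projectivity is carried along so that the next step stays exact. -/
theorem IsSyzygy.projective_left_and_hasInjectiveDimensionLE_iff (Y : ModuleCat.{u} Λ) {n : ℕ}
    {M N : ModuleCat.{u} (EnvelopingAlgebra k Λ)} (h : IsSyzygy n M N) [Module.Projective Λ M] :
    Module.Projective Λ N ∧ ∀ j, HasInjectiveDimensionLE ((LeftHom.functor k Y).obj (.op N)) j ↔
      HasInjectiveDimensionLE ((LeftHom.functor k Y).obj (.op M)) (j + n) := by
  induction n generalizing M with
  | zero =>
    obtain ⟨e⟩ := h
    let e' := (LeftHom.functor k Y).mapIso e.op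
    exact ⟨projective_left_of_iso e, fun j ↦ ⟨fun _ ↦ hasInjectiveDimensionLT_of_iso e' _,
      fun _ ↦ hasInjectiveDimensionLT_of_iso e'.symm _⟩⟩
  | succ n ih =>
    obtain ⟨P, f, hf, hN⟩ := h
    have hS := LinearMap.shortExact_shortComplexKer hf.surjective
    have := hf.projective
    have := projective_left_of_projective P
    have : Module.Projective Λ (ModuleCat.of (EnvelopingAlgebra k Λ) (LinearMap.ker f.hom)) :=
      projective_left_kernel hS
    obtain ⟨hproj, hdim⟩ := ih hN
    refine ⟨hproj, fun j ↦ (hdim j).trans ?_⟩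
    exact (LeftHom.shortExact_functor Y hS).hasInjectiveDimensionLT_X₃_iff (j + n)
      (LeftHom.injective_functor_obj k P Y)

theorem IsPeriodicModule.injective_functor_obj {N : ModuleCat.{u} (EnvelopingAlgebra k Λ)}
    (hN : IsPeriodicModule N) [Module.Projective Λ N] (Y : ModuleCat.{u} Λ) (m : ℕ)
    (hm : HasInjectiveDimensionLE ((LeftHom.functor k Y).obj (.op N)) m) :
    HasInjectiveDimensionLE ((LeftHom.functor k Y).obj (.op N)) 0 := by
  obtain ⟨p, hp, h⟩ := hN
  have hdim := (h.projective_left_and_hasInjectiveDimensionLE_iff Y).2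
  have (j t : ℕ) : HasInjectiveDimensionLE ((LeftHom.functor k Y).obj (.op N)) j ↔
      HasInjectiveDimensionLE ((LeftHom.functor k Y).obj (.op N)) (j + p * t) := by
    induction t with
    | zero => rfl
    | succ t ih => rw [ih, hdim, Nat.mul_succ, add_assoc]
  rw [this 0 m]
  -- Going around the period `m` times suffices: `p * m ≥ m`.
  exact hasInjectiveDimensionLT_of_ge _ (m + 1) _ (by nlinarith)

theorem regularBimodule_smul_left (a : Λ) (x : regularBimodule k Λ) :
    a • x = (show regularBimodule k Λ from a * (show Λ from x)) := by
  refine (regularBimodule_smul k Λ a 1 x).trans ?_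
  rw [mul_one]

instance projective_left_regularBimodule : Module.Projective Λ (regularBimodule k Λ) :=
  let e : Λ ≃ₗ[Λ] regularBimodule k Λ :=
    { AddEquiv.refl Λ with
      map_smul' a x := (regularBimodule_smul_left (k := k) a x).symm }
  Module.Projective.of_equiv e

/-- Evaluation at `1` is an isomorphism `Hom_Λ(Λ, Y) ≅ Y`. -/
noncomputable def LeftHom.regularIso (Y : ModuleCat.{u} Λ) :
    (LeftHom.functor k Y).obj (.op (regularBimodule k Λ)) ≅ Y :=
  LinearEquiv.toModuleIso <| LinearEquiv.ofBijective
    (M := LeftHom (regularBimodule k Λ) Y)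
    { toFun f := f (show regularBimodule k Λ from (1 : Λ))
      map_add' f g := rfl
      map_smul' b f := by
        rw [LeftHom.smul_apply, regularBimodule_smul, RingHom.id_apply, ← map_smul,
          regularBimodule_smul_left, mul_one, one_mul, mul_one] }
    ⟨fun f g h ↦ LeftHom.ext fun x ↦ by
      have hx : x = (show Λ from x) • (show regularBimodule k Λ from (1 : Λ)) := by
        rw [regularBimodule_smul_left]; exact (mul_one (show Λ from x)).symm
      rw [hx, map_smul, map_smul]
      exact congrArg _ h,
    fun y ↦ ⟨
      { toFun x := (show Λ from x) • y
        map_add' x x' := add_smul (show Λ from x) (show Λ from x') y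
        map_smul' a x := by
          rw [regularBimodule_smul_left]
          exact mul_smul a (show Λ from x) y },
      one_smul Λ y⟩⟩

/-- The bound `m` serves only as finiteness; the conclusion does not depend on its size. -/
theorem HasPeriodicSyzygy.hasInjectiveDimensionLE {n m : ℕ}
    (h : HasPeriodicSyzygy (regularBimodule k Λ) n) (Y : ModuleCat.{u} Λ)
    (hY : HasInjectiveDimensionLE Y m) : HasInjectiveDimensionLE Y n := by
  obtain ⟨N, hN, hper⟩ := h
  obtain ⟨_, hdim⟩ := hN.projective_left_and_hasInjectiveDimensionLE_iff Y
  have e := LeftHom.regularIso (k := k) Y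
  have h₁ : HasInjectiveDimensionLE ((LeftHom.functor k Y).obj (.op N)) m :=
    (hdim m).2 <| 
      have := hasInjectiveDimensionLT_of_ge Y (m + 1) (m + n + 1) (by lia)
      hasInjectiveDimensionLT_of_iso e.symm (m + n + 1)
  have h₂ := (hdim 0).1 (hper.injective_functor_obj Y m h₁)
  rw [zero_add] at h₂
  exact hasInjectiveDimensionLT_of_iso e _

end LeftHom

/-! ### The main theorem. -/

theorem proposition4p2 {k : Type v} [Field k] [IsAlgClosed k]
    {Λ : Type u} [Ring Λ] [Algebra k Λ] [FiniteDimensional k Λ]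
    (d : ℕ) (hΛ : IsDGorenstein Λ d)
    (hper : ∃ n : ℕ, HasPeriodicSyzygy (regularBimodule k Λ) n) :
    ∃ n : ℕ, IsLeast {m : ℕ | HasPeriodicSyzygy (regularBimodule k Λ) m} n ∧
      d ≤ n ∧
      (n = d ↔ ∃ S : ModuleCat.{u} Λ, IsSimpleModule Λ S ∧
        Nontrivial (Abelian.Ext S (ModuleCat.of Λ Λ) n)) := by
  classical
  have : IsArtinianRing Λ := IsArtinianRing.of_finite k Λ
  have hd : HasInjectiveDimensionLE (ModuleCat.of Λ Λ) d :=
    (injectiveDimension_le_iff _ _).1 hΛ.left_eq.le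
  have hd' : ¬ HasInjectiveDimensionLT (ModuleCat.of Λ Λ) d :=
    (injectiveDimension_ge_iff _ _).1 hΛ.left_eq.ge
  have hle (n : ℕ) (hn : HasInjectiveDimensionLE (ModuleCat.of Λ Λ) n) : d ≤ n :=
    not_lt.1 fun h ↦ hd' (hasInjectiveDimensionLT_of_ge _ (n + 1) d h)
  refine ⟨Nat.find hper, ⟨Nat.find_spec hper, fun _ ↦ Nat.find_min' hper⟩,
    hle _ ((Nat.find_spec hper).hasInjectiveDimensionLE _ hd), fun h ↦ ?_, ?_⟩
  -- If `Extᵈ(S, Λ)` vanished for every simple `S`, the injective dimension would drop below `d`.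
  · by_contra! hS
    rw [h] at hS
    exact hd' (hasInjectiveDimensionLT_of_subsingleton_ext_simple hS)
  · rintro ⟨S, -, hS⟩
    -- A nonzero `Extⁿ(S, Λ)` is impossible for `n > d`.
    refine le_antisymm (not_lt.1 fun hlt ↦ ?_)
      (hle _ ((Nat.find_spec hper).hasInjectiveDimensionLE _ hd))
    exact not_subsingleton _ (HasInjectiveDimensionLT.subsingleton (ModuleCat.of Λ Λ) (d + 1) _ hlt S)
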